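/- Let $0\le a,b\le\infty$ and $\mu>0$. On $\mathbb{R}^3$ set $$K_{a,b}(x)=\frac1{|x|}\Bigl(\tfrac43 e^{-b|x|}-\tfrac13 e^{-a|x|}-1\Bigr),\qquad e^{-0|x|}:=1,\quad e^{-\infty|x|}:=0 .$$ For a measurable potential $V:\mathbb{R}^3\to\mathbb{R}$ (identified up to a.e. equality) and real-valued $u\in H^1(\mathbb{R}^3)$ let $$\mathcal{E}^V_{a,b}(u)=\frac12\int|\nabla u|^2\,dx+\frac12\int V u^2\,dx+\frac14\iint K_{a,b}(x-y)\,u(x)^2u(y)^2\,dx\,dy ,$$ $$\mathcal{S}(\mu)=\{u\in H^1(\mathbb{R}^3):\|u\|_{L^2}^2=\mu\},\qquad E^V_{a,b}(\mu)=\inf_{v\in\mathcal{S}(\mu)}\mathcal{E}^V_{a,b}(v).$$ A ground state (for $a$, $b$, $V$, $\mu$) is a $u\in\mathcal{S}(\mu)$ with $\mathcal{E}^V_{a,b}(u)=E^V_{a,b}(\mu)$; the autonomous problem is the case $V\equiv0$. Consider the conditions * $(\mathrm{H}_1)$ $V\in L^{3/2}(\mathbb{R}^3)+L^\infty(\mathbb{R}^3)$;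 * $(\mathrm{H}_2)$ $\operatorname{meas}\{x\in\mathbb{R}^3:|V(x)|>c\}<\infty$ for every $c>0$; * $(\mathrm{H}_3)$ (energy deficiency) $E^V_{a,b}(\mu)<E^0_{a,b}(\mu)$. Then the following hold. 1. If $V$ satisfies $(\mathrm{H}_1)$, the autonomous problem admits a ground state in $\mathcal{S}(\mu)$, $V\le0$ a.e., and $V$ is not a.e. equal to $0$, then $V$ satisfies $(\mathrm{H}_3)$. 2. Suppose that $V_1$ satisfies $(\mathrm{H}_1)$, $(\mathrm{H}_2)$ and $(\mathrm{H}_3)$. Then there exists $K>0$ (depending on $V_1$, for the given $a,b,\mu$) with the following property: if $V_2\in L^{3/2}(\mathbb{R}^3)$ and $V_3\in L^\infty(\mathbb{R}^3)$ are such that $$\operatorname{meas}\{x\in\mathbb{R}^3:|V_2(x)+V_3(x)|>c\}<\infty\quad\text{for every }c>0$$ and $$K\|V_2\|_{L^{3/2}}+\frac12\|V_3\|_{L^\infty}\,\mu<E^0_{a,b}(\mu)-E^{V_1}_{a,b}(\mu),$$ then $V_1+V_2+V_3$ satisfies $(\mathrm{H}_1)$, $(\mathrm{H}_2)$ and $(\mathrm{H}_3)$.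 Moreover, for every ground state $u\in\mathcal{S}(\mu)$ of $\mathcal{E}^{V_1}_{a,b}|_{\mathcal{S}(\mu)}$, one has $u\in L^6(\mathbb{R}^3)$, and $K=\frac12\|u\|_{L^6}^2$ is positive and has this property. -/

import Mathlib

open MeasureTheory Set
open scoped ENNReal ContDiff

noncomputable section

/-- Three-dimensional Euclidean space. -/
abbrev R3 : Type := EuclideanSpace ℝ (Fin 3)

/-- `g` is a distributional (weak) gradient of `u`: integration by parts holds against every
smooth compactly supported test function, in every direction. -/
def IsWeakGradient (u : R3 → ℝ) (g : R3 → R3) : Prop :=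
  ∀ φ : R3 → ℝ, ContDiff ℝ ∞ φ → HasCompactSupport φ → ∀ v : R3,
    ∫ x, u x * fderiv ℝ φ x v = - ∫ x, inner ℝ (g x) v * φ x

/-- Membership in the Sobolev space `H¹(ℝ³)` of real-valued functions. -/
def MemH1 (u : R3 → ℝ) : Prop :=
  MemLp u 2 volume ∧ ∃ g : R3 → R3, MemLp g 2 volume ∧ IsWeakGradient u g

open Classical in
/-- The weak gradient of a function in `H¹(ℝ³)` (which is unique almost everywhere). -/
def weakGrad (u : R3 → ℝ) : R3 → R3 :=
  if h : MemH1 u then h.2.choose else 0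

/-- The factor `e^{-c r}` for `c ∈ [0, ∞]`, with `e^{-∞ r} = 0` (also for `r = 0`). -/
def expNeg (c : ℝ≥0∞) (r : ℝ) : ℝ :=
  if c = ⊤ then 0 else Real.exp (-(c.toReal * r))

/-- The kernel `K_{a,b}(x) = |x|⁻¹ (4/3 e^{-b|x|} - 1/3 e^{-a|x|} - 1)`. -/
def kernelK (a b : ℝ≥0∞) (x : R3) : ℝ :=
  1 / ‖x‖ * (4 / 3 * expNeg b ‖x‖ - 1 / 3 * expNeg a ‖x‖ - 1)

/-- `∫ |∇u|²`. -/
def dirichletForm (u : R3 → ℝ) : ℝ := ∫ x, ‖weakGrad u x‖ ^ 2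

/-- `∫ V u²`. -/
def potentialForm (V u : R3 → ℝ) : ℝ := ∫ x, V x * u x ^ 2

/-- `∫∫ K_{a,b}(x - y) u(x)² u(y)² dx dy`. -/
def interactionForm (a b : ℝ≥0∞) (u : R3 → ℝ) : ℝ :=
  ∫ y, ∫ x, kernelK a b (x - y) * u x ^ 2 * u y ^ 2

/-- The energy functional with external potential `V`; the autonomous one is the case `V = 0`. -/
def energy (a b : ℝ≥0∞) (V u : R3 → ℝ) : ℝ :=
  1 / 2 * dirichletForm u + 1 / 2 * potentialForm V u + 1 / 4 * interactionForm a b u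

/-- The sphere `{u ∈ H¹(ℝ³) : ‖u‖²_{L²} = μ}`. -/
def massSphere (μ : ℝ) : Set (R3 → ℝ) :=
  {u | MemH1 u ∧ ∫ x, u x ^ 2 = μ}

/-- The ground state energy: the infimum of the energy over the sphere of mass `μ`, taken in the
extended reals so that no boundedness is presupposed. -/
def groundEnergy (a b : ℝ≥0∞) (V : R3 → ℝ) (μ : ℝ) : EReal :=
  ⨅ u ∈ massSphere μ, (energy a b V u : EReal)

/-- `u` is a ground state: a minimizer of the energy on the sphere of mass `μ`. -/
def IsGroundState (a b : ℝ≥0∞) (V : R3 → ℝ) (μ : ℝ) (u : R3 → ℝ) : Prop :=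
  u ∈ massSphere μ ∧ (energy a b V u : EReal) = groundEnergy a b V μ

/-- `V ∈ L^{3/2} + L^∞`. -/
def MemL32AddLinf (V : R3 → ℝ) : Prop :=
  ∃ W W' : R3 → ℝ, MemLp W (3 / 2) volume ∧ MemLp W' ⊤ volume ∧ V =ᵐ[volume] W + W'

/-- `V` vanishes at infinity, in the measure sense. -/
def VanishesAtInfinity (V : R3 → ℝ) : Prop :=
  ∀ c : ℝ, 0 < c → volume {x | c < |V x|} < ⊤

/-- The energy deficiency condition. -/
def EnergyDeficient (a b : ℝ≥0∞) (V : R3 → ℝ) (μ : ℝ) : Prop :=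
  groundEnergy a b V μ < groundEnergy a b 0 μ

/-- The three hypotheses on the potential together. -/
def IsAdmissiblePotential (a b : ℝ≥0∞) (V : R3 → ℝ) (μ : ℝ) : Prop :=
  MemL32AddLinf V ∧ VanishesAtInfinity V ∧ EnergyDeficient a b V μ

/-- The constant `K` works in the perturbation statement for the potential `V₁`. -/
def IsPerturbationConstant (a b : ℝ≥0∞) (V₁ : R3 → ℝ) (μ K : ℝ) : Prop :=
  ∀ V₂ V₃ : R3 → ℝ, MemLp V₂ (3 / 2) volume → MemLp V₃ ⊤ volume →
    VanishesAtInfinity (V₂ + V₃) →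
    ((K * lpNorm V₂ (3 / 2) volume + 1 / 2 * lpNorm V₃ ⊤ volume * μ : ℝ) : EReal)
      < groundEnergy a b 0 μ - groundEnergy a b V₁ μ →
    IsAdmissiblePotential a b (V₁ + V₂ + V₃) μ

end

/-! Deficiency: the autonomous energy is translation invariant, so each translate of an autonomous
ground state `u` has energy `E⁰ + ½∫ V u(·+y)²` in the presence of `V`. Integrating the last
integral over `y` gives `μ∫V < 0`, possibly `-∞`, so some translate goes strictly below `E⁰`
(`exists_potentialForm_comp_add_right_neg`).

Perturbation: take a near-minimizer `u` for `V₁` as trial function for `V₁ + V₂ + V₃`. By Hölder the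
energy rises by at most `½‖u‖₆²‖V₂‖_{3/2} + ½‖V₃‖_∞ μ`, so any `K` bounding `½‖u‖₆²` along a
minimizing sequence works (`isPerturbationConstant_of_forall_exists`). A ground state is its own
minimizing sequence. In general the bound comes from coercivity: potentials in `L^{3/2} + L^∞` are
infinitesimally form bounded, the kernel belongs to this class, and so the energy dominates
`¼∫|∇u|²` up to a constant (`exists_dirichletForm_le_energy`). The Sobolev inequality turns this
into an `L⁶` bound. -/

/-! ### Mollification and weak gradients. -/

section Mollification

open scoped Convolution Topology

lemma eLpNorm_two_rpow_eq_lintegral {F : Type*} [NormedAddCommGroup F]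
    {α : Type*} [MeasurableSpace α] (ν : Measure α) (f : α → F) :
    eLpNorm f 2 ν ^ (2 : ℝ) = ∫⁻ x, ‖f x‖ₑ ^ (2 : ℝ) ∂ν := by
  have := eLpNorm_nnreal_pow_eq_lintegral (f := f) (μ := ν) (p := 2) (by norm_num)
  simpa using this

variable {F : Type*} [NormedAddCommGroup F] [NormedSpace ℝ F]

/-- Jensen's inequality for the probability density `w`: Cauchy–Schwarz applied to `w f = w^{1/2} (w
f²)^{1/2}`. -/
lemma rpow_two_lintegral_mul_le {α : Type*} [MeasurableSpace α] {ν : Measure α}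
    {w f : α → ℝ≥0∞} (hw : AEMeasurable w ν) (hf : AEMeasurable f ν) (h1 : ∫⁻ t, w t ∂ν = 1) :
    (∫⁻ t, w t * f t ∂ν) ^ (2 : ℝ) ≤ ∫⁻ t, w t * f t ^ (2 : ℝ) ∂ν := by
  have h := ENNReal.lintegral_mul_norm_pow_le (μ := ν) hw (hw.mul (hf.pow_const (2 : ℝ)))
    (p := 1 / 2) (q := 1 / 2) (by norm_num) (by norm_num) (by norm_num)
  have e : ∀ t, w t ^ (1 / 2 : ℝ) * (w t * f t ^ (2 : ℝ)) ^ (1 / 2 : ℝ) = w t * f t := by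
    intro t
    rw [ENNReal.mul_rpow_of_nonneg _ _ (by norm_num), ← mul_assoc,
      ← ENNReal.rpow_add_of_nonneg _ _ (by norm_num) (by norm_num), ← ENNReal.rpow_mul]
    norm_num
  simp only [Pi.mul_apply, e, h1, ENNReal.one_rpow, one_mul] at h
  calc _ ≤ ((∫⁻ t, w t * f t ^ (2 : ℝ) ∂ν) ^ (1 / 2 : ℝ)) ^ (2 : ℝ) := by gcongr
    _ = _ := by rw [← ENNReal.rpow_mul]; norm_num

lemma lintegral_enorm_normed (φ : ContDiffBump (0 : R3)) :
    ∫⁻ t, ‖φ.normed volume t‖ₑ = 1 := by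
  have h := ofReal_integral_eq_lintegral_ofReal (φ.integrable_normed (μ := volume))
    (.of_forall fun x => φ.nonneg_normed x)
  rw [φ.integral_normed, ENNReal.ofReal_one] at h
  rw [h]
  exact lintegral_congr fun t => Real.enorm_eq_ofReal (φ.nonneg_normed t)

/-- Mollification is a contraction of `L²`. -/
lemma eLpNorm_two_normed_convolution_le (φ : ContDiffBump (0 : R3)) {g : R3 → F}
    (hg : AEStronglyMeasurable g volume) :
    eLpNorm (fun x => ∫ t, φ.normed volume t • g (x - t)) 2 volume ≤ eLpNorm g 2 volume := by
  have hw : Measurable fun t => ‖φ.normed volume t‖ₑ :=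
    φ.continuous_normed.measurable.enorm
  have hprod : AEMeasurable (fun p : R3 × R3 => ‖g (p.1 - p.2)‖ₑ) (volume.prod volume) :=
    hg.enorm.comp_quasiMeasurePreserving
      (quasiMeasurePreserving_sub_of_right_invariant volume volume)
  rw [← ENNReal.rpow_le_rpow_iff (z := 2) (by norm_num), eLpNorm_two_rpow_eq_lintegral,
    eLpNorm_two_rpow_eq_lintegral]
  calc ∫⁻ x, ‖∫ t, φ.normed volume t • g (x - t)‖ₑ ^ (2 : ℝ)
      ≤ ∫⁻ x, ∫⁻ t, ‖φ.normed volume t‖ₑ * ‖g (x - t)‖ₑ ^ (2 : ℝ) := by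
        refine lintegral_mono fun x => ?_
        refine le_trans ?_ (rpow_two_lintegral_mul_le hw.aemeasurable ?_
          (lintegral_enorm_normed φ))
        · gcongr
          refine (enorm_integral_le_lintegral_enorm _).trans_eq ?_
          simp_rw [enorm_smul]
        · exact hg.enorm.comp_quasiMeasurePreserving
            (quasiMeasurePreserving_sub_left volume x)
    _ = ∫⁻ t, ∫⁻ x, ‖φ.normed volume t‖ₑ * ‖g (x - t)‖ₑ ^ (2 : ℝ) := by
        refine lintegral_lintegral_swap ?_
        exact (hw.aemeasurable.comp_quasiMeasurePreserving
          Measure.quasiMeasurePreserving_snd).mul (hprod.pow_const _)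
    _ = ∫⁻ t, ‖φ.normed volume t‖ₑ * ∫⁻ x, ‖g x‖ₑ ^ (2 : ℝ) := by
        refine lintegral_congr fun t => ?_
        rw [lintegral_const_mul' _ _ enorm_ne_top,
          lintegral_sub_right_eq_self (fun x => ‖g x‖ₑ ^ (2 : ℝ))]
    _ = ∫⁻ x, ‖g x‖ₑ ^ (2 : ℝ) := by
        rw [lintegral_mul_const _ hw, lintegral_enorm_normed, one_mul]

/-- The mollification of a function by a normalized bump function. -/
noncomputable def mollify (φ : ContDiffBump (0 : R3)) (g : R3 → F) : R3 → F :=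
  φ.normed volume ⋆[ContinuousLinearMap.lsmul ℝ ℝ, volume] g

lemma mollify_apply (φ : ContDiffBump (0 : R3)) (g : R3 → F) (x : R3) :
    mollify φ g x = ∫ t, φ.normed volume t • g (x - t) := rfl

lemma mollify_apply_swap (φ : ContDiffBump (0 : R3)) (g : R3 → F) (x : R3) :
    mollify φ g x = ∫ t, φ.normed volume (x - t) • g t := by
  rw [mollify_apply, ← integral_sub_left_eq_self _ volume x]
  simp

lemma eLpNorm_mollify_le (φ : ContDiffBump (0 : R3)) {g : R3 → F}
    (hg : AEStronglyMeasurable g volume) :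
    eLpNorm (mollify φ g) 2 volume ≤ eLpNorm g 2 volume :=
  eLpNorm_two_normed_convolution_le φ hg

lemma contDiff_mollify (φ : ContDiffBump (0 : R3)) {u : R3 → ℝ}
    (hu : LocallyIntegrable u volume) : ContDiff ℝ ∞ (mollify φ u) :=
  φ.hasCompactSupport_normed.contDiff_convolution_left _ φ.contDiff_normed hu

/-- The derivative of a mollification is the mollification of the weak gradient. -/
lemma fderiv_mollify_apply (φ : ContDiffBump (0 : R3)) {u : R3 → ℝ} {g : R3 → R3}
    (hu : LocallyIntegrable u volume) (hg : LocallyIntegrable g volume)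
    (h : IsWeakGradient u g) (x v : R3) :
    fderiv ℝ (mollify φ u) x v = inner ℝ (mollify φ g x) v := by
  set ρ : R3 → ℝ := φ.normed volume with hρ
  have hρs : HasCompactSupport ρ := φ.hasCompactSupport_normed
  have hρd : ContDiff ℝ ∞ ρ := φ.contDiff_normed
  have hder : HasFDerivAt (mollify φ u)
      ((u ⋆[(ContinuousLinearMap.lsmul ℝ ℝ).flip.precompR R3, volume] fderiv ℝ ρ) x) x := by
    have := hρs.hasFDerivAt_convolution_right (ContinuousLinearMap.lsmul ℝ ℝ).flip hu
      (hρd.of_le (by simp)) x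
    rwa [convolution_flip] at this
  rw [hder.fderiv, convolution_precompR_apply _ hu (hρs.fderiv ℝ)
    (hρd.continuous_fderiv (by simp))]
  have hψ : ∀ t, HasFDerivAt (fun t => ρ (x - t)) (-(fderiv ℝ ρ (x - t))) t := by
    intro t
    have h1 := (hρd.differentiable (by simp) (x - t)).hasFDerivAt
    have h2 := h1.comp t ((hasFDerivAt_const x t).sub (hasFDerivAt_id t))
    refine h2.congr_fderiv ?_
    ext w
    simp
  have hψs : HasCompactSupport fun t => ρ (x - t) :=
    hρs.comp_homeomorph (Homeomorph.subLeft x)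
  -- The reflected mollifier is the test function; the sign from `t ↦ x - t` cancels the one from
  -- integration by parts.
  have hw := h (fun t => ρ (x - t)) (hρd.comp (contDiff_const.sub contDiff_id)) hψs v
  have hint : Integrable (fun t => ρ (x - t) • g t) volume :=
    hg.integrable_smul_left_of_hasCompactSupport
      (hρd.continuous.comp (continuous_const.sub continuous_id)) hψs
  rw [mollify_apply_swap, real_inner_comm, ← integral_inner hint]
  simp only [convolution, ContinuousLinearMap.flip_apply, ContinuousLinearMap.lsmul_apply,
    smul_eq_mul]
  simp only [(hψ _).fderiv, _root_.neg_apply, mul_neg, integral_neg, neg_inj] at hw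
  calc _ = ∫ t, u t * fderiv ℝ ρ (x - t) v := by congr 1; ext t; ring
    _ = _ := by
      rw [hw]
      congr 1
      ext t
      rw [inner_smul_right, real_inner_comm, mul_comm]

lemma norm_fderiv_mollify_le (φ : ContDiffBump (0 : R3)) {u : R3 → ℝ} {g : R3 → R3}
    (hu : LocallyIntegrable u volume) (hg : LocallyIntegrable g volume)
    (h : IsWeakGradient u g) (x : R3) :
    ‖fderiv ℝ (mollify φ u) x‖ ≤ ‖mollify φ g x‖ := by
  refine ContinuousLinearMap.opNorm_le_bound _ (norm_nonneg _) fun v => ?_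
  rw [fderiv_mollify_apply φ hu hg h]
  exact norm_inner_le_norm _ _

end Mollification

/-! ### The Sobolev embedding of `H¹` into `L⁶`. -/

section Sobolev

open Filter
open scoped Topology

/-- The Sobolev constant of the embedding of `H¹(ℝ³)` into `L⁶(ℝ³)`. -/
noncomputable def sobolevConst : NNReal :=
  eLpNormLESNormFDerivOfEqInnerConst (volume : Measure R3) (2 : NNReal)

/-- A bump function used as a cut-off. -/
noncomputable def cutoffBump : ContDiffBump (0 : R3) := ⟨1, 2, one_pos, one_lt_two⟩

/-- A sequence of bump functions concentrating at the origin. -/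
noncomputable def bumpSeq (n : ℕ) : ContDiffBump (0 : R3) :=
  ⟨1 / (n + 1 : ℝ), 2 / (n + 1 : ℝ), by positivity, by gcongr; norm_num⟩

/-- Smooth cut-offs exhausting the space. -/
noncomputable def cutoff (n : ℕ) (x : R3) : ℝ := cutoffBump ((n + 1 : ℝ)⁻¹ • x)

lemma contDiff_cutoff (n : ℕ) : ContDiff ℝ ∞ (cutoff n) :=
  cutoffBump.contDiff.comp (contDiff_const_smul _)

lemma hasCompactSupport_cutoff (n : ℕ) : HasCompactSupport (cutoff n) :=
  cutoffBump.hasCompactSupport.comp_homeomorph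
    (Homeomorph.smulOfNeZero ((n + 1 : ℝ)⁻¹) (by positivity))

lemma norm_cutoff_le (n : ℕ) (x : R3) : ‖cutoff n x‖ ≤ 1 := by
  rw [cutoff, Real.norm_of_nonneg cutoffBump.nonneg]
  exact cutoffBump.le_one

lemma tendsto_cutoff (x : R3) : Tendsto (fun n => cutoff n x) atTop (𝓝 1) := by
  have h : Tendsto (fun n : ℕ => ((n + 1 : ℝ)⁻¹) • x) atTop (𝓝 0) := by
    have := (tendsto_one_div_add_atTop_nhds_zero_nat (𝕜 := ℝ)).smul_const x
    simpa using this
  refine tendsto_const_nhds.congr' ?_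
  filter_upwards [h.eventually (Metric.closedBall_mem_nhds 0 one_pos)] with n hn
  exact (cutoffBump.one_of_mem_closedBall hn).symm

lemma exists_norm_fderiv_cutoff_le :
    ∃ M : NNReal, ∀ n x, ‖fderiv ℝ (cutoff n) x‖ ≤ M * (n + 1 : ℝ)⁻¹ := by
  have hc : Continuous (fderiv ℝ (cutoffBump : R3 → ℝ)) :=
    cutoffBump.contDiff.continuous_fderiv (n := 1) (by simp)
  obtain ⟨M, hM⟩ := hc.bounded_above_of_compact_support
    (cutoffBump.hasCompactSupport.fderiv ℝ)
  have hM0 : 0 ≤ M := (norm_nonneg _).trans (hM 0)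
  refine ⟨⟨M, hM0⟩, fun n x => ?_⟩
  have hd : DifferentiableAt ℝ (cutoffBump : R3 → ℝ) ((n + 1 : ℝ)⁻¹ • x) :=
    (cutoffBump.contDiff (n := 1)).differentiable (by simp) _
  have h1 : HasFDerivAt (cutoff n) ((fderiv ℝ (cutoffBump : R3 → ℝ) ((n + 1 : ℝ)⁻¹ • x)).comp
      ((n + 1 : ℝ)⁻¹ • ContinuousLinearMap.id ℝ R3)) x :=
    hd.hasFDerivAt.comp x ((hasFDerivAt_id x).const_smul ((n + 1 : ℝ)⁻¹))
  rw [h1.fderiv]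
  refine (ContinuousLinearMap.opNorm_comp_le _ _).trans ?_
  gcongr
  · exact hM _
  · rw [norm_smul, Real.norm_of_nonneg (by positivity)]
    exact mul_le_of_le_one_right (by positivity) ContinuousLinearMap.norm_id_le

lemma eLpNorm_six_le_fderiv {w : R3 → ℝ} (hw : ContDiff ℝ 1 w) (hs : HasCompactSupport w) :
    eLpNorm w 6 volume ≤ sobolevConst * eLpNorm (fderiv ℝ w) 2 volume := by
  have := eLpNorm_le_eLpNorm_fderiv_of_eq_inner (volume : Measure R3) hw hs (p := 2) (p' := 6)
    (by norm_num) (by simp) (by simp; norm_num)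
  simpa [sobolevConst] using this

/-- The **Sobolev inequality** for functions in `H¹(ℝ³)`. -/
theorem eLpNorm_six_le_of_isWeakGradient {u : R3 → ℝ} {g : R3 → R3} (hu : MemLp u 2 volume)
    (hg : MemLp g 2 volume) (h : IsWeakGradient u g) :
    eLpNorm u 6 volume ≤ sobolevConst * eLpNorm g 2 volume := by
  have hul := hu.locallyIntegrable one_le_two
  have hgl := hg.locallyIntegrable one_le_two
  obtain ⟨M, hM⟩ := exists_norm_fderiv_cutoff_le
  set m : ℕ → R3 → ℝ := fun n => mollify (bumpSeq n) u with hm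
  set w : ℕ → R3 → ℝ := fun n x => cutoff n x * m n x with hwdef
  have hms : ∀ n, ContDiff ℝ ∞ (m n) := fun n => contDiff_mollify _ hul
  have hws : ∀ n, ContDiff ℝ ∞ (w n) := fun n => (contDiff_cutoff n).mul (hms n)
  have hwc : ∀ n, HasCompactSupport (w n) := fun n => (hasCompactSupport_cutoff n).mul_right
  have hlim : ∀ᵐ x, Tendsto (fun n => w n x) atTop (𝓝 (u x)) := by
    have h0 : Tendsto (fun n => (bumpSeq n).rOut) atTop (𝓝 0) := by
      have := (tendsto_one_div_add_atTop_nhds_zero_nat (𝕜 := ℝ)).const_mul 2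
      simpa [bumpSeq, div_eq_mul_inv] using this
    -- A bounded ratio of the radii is required for a.e. convergence of mollifications of a merely
    -- locally integrable function.
    have h1 : ∀ᶠ n in atTop, (bumpSeq n).rOut ≤ 2 * (bumpSeq n).rIn :=
      .of_forall fun n => by simp [bumpSeq, div_eq_mul_inv]
    filter_upwards [ContDiffBump.ae_convolution_tendsto_right_of_locallyIntegrable h0 h1 hul]
      with x hx
    have h2 := (tendsto_cutoff x).mul hx
    rwa [one_mul] at h2
  -- The product rule leaves the mollified gradient, contracted in `L²`, and an error from the
  -- cut-off whose factor `M/(n+1)` tends to zero.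
  have hbound : ∀ n, eLpNorm (w n) 6 volume ≤ sobolevConst * (eLpNorm g 2 volume +
      ENNReal.ofReal (M * (n + 1 : ℝ)⁻¹) * eLpNorm u 2 volume) := by
    intro n
    refine (eLpNorm_six_le_fderiv ((hws n).of_le (by simp)) (hwc n)).trans ?_
    gcongr
    have hd : fderiv ℝ (w n) = fun x => cutoff n x • fderiv ℝ (m n) x
        + m n x • fderiv ℝ (cutoff n) x := by
      ext1 x
      exact fderiv_fun_mul ((contDiff_cutoff n).differentiable (by simp) x)
        ((hms n).differentiable (by simp) x)
    rw [hd]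
    have c1 : Continuous fun x => cutoff n x • fderiv ℝ (m n) x :=
      (contDiff_cutoff n).continuous.smul ((hms n).continuous_fderiv (by simp))
    have c2 : Continuous fun x => m n x • fderiv ℝ (cutoff n) x :=
      (hms n).continuous.smul ((contDiff_cutoff n).continuous_fderiv (by simp))
    refine (eLpNorm_add_le c1.aestronglyMeasurable c2.aestronglyMeasurable one_le_two).trans ?_
    gcongr
    · refine le_trans ?_ (eLpNorm_mollify_le (bumpSeq n) hg.1)
      refine eLpNorm_mono fun x => ?_
      rw [norm_smul]
      calc _ ≤ 1 * ‖mollify (bumpSeq n) g x‖ := by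
            gcongr
            · exact norm_cutoff_le n x
            · exact norm_fderiv_mollify_le _ hul hgl h x
        _ = _ := one_mul _
    · refine le_trans ?_ (mul_le_mul_right (eLpNorm_mollify_le (bumpSeq n) hu.1) _)
      refine eLpNorm_le_mul_eLpNorm_of_ae_le_mul (.of_forall fun x => ?_) 2
      rw [norm_smul, mul_comm]
      gcongr
      exact hM n x
  -- Fatou's lemma: a.e. convergence suffices to pass the bound to `u`.
  refine (Lp.eLpNorm_lim_le_liminf_eLpNorm
    (fun n => (hws n).continuous.aestronglyMeasurable) u hlim).trans ?_
  refine (liminf_le_liminf (.of_forall hbound)).trans_eq ?_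
  refine Tendsto.liminf_eq ?_
  have ht : Tendsto (fun n : ℕ => ENNReal.ofReal (M * (n + 1 : ℝ)⁻¹)) atTop (𝓝 0) := by
    have := (tendsto_one_div_add_atTop_nhds_zero_nat (𝕜 := ℝ)).const_mul (M : ℝ)
    have := ENNReal.tendsto_ofReal this
    simpa using this
  have ht2 := ENNReal.Tendsto.mul_const ht (.inr hu.eLpNorm_ne_top)
  have ht3 := ENNReal.Tendsto.const_mul (ht2.const_add (eLpNorm g 2 volume))
    (a := (sobolevConst : ℝ≥0∞)) (.inr ENNReal.coe_ne_top)
  simpa using ht3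

lemma MemH1.memLp_weakGrad {u : R3 → ℝ} (hu : MemH1 u) : MemLp (weakGrad u) 2 volume := by
  rw [weakGrad, dif_pos hu]
  exact hu.2.choose_spec.1

lemma MemH1.isWeakGradient {u : R3 → ℝ} (hu : MemH1 u) : IsWeakGradient u (weakGrad u) := by
  rw [weakGrad, dif_pos hu]
  exact hu.2.choose_spec.2

lemma MemH1.eLpNorm_six_le {u : R3 → ℝ} (hu : MemH1 u) :
    eLpNorm u 6 volume ≤ sobolevConst * eLpNorm (weakGrad u) 2 volume :=
  eLpNorm_six_le_of_isWeakGradient hu.1 hu.memLp_weakGrad hu.isWeakGradient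

lemma MemH1.memLp_six {u : R3 → ℝ} (hu : MemH1 u) : MemLp u 6 volume :=
  ⟨hu.1.1, hu.eLpNorm_six_le.trans_lt
    (ENNReal.mul_lt_top ENNReal.coe_lt_top hu.memLp_weakGrad.eLpNorm_lt_top)⟩

end Sobolev

/-! ### Translation invariance of the autonomous energy. -/

section Translation

/-- Weak gradients are unique almost everywhere. -/
lemma IsWeakGradient.ae_eq {u : R3 → ℝ} {g g' : R3 → R3} (hg : LocallyIntegrable g volume)
    (hg' : LocallyIntegrable g' volume) (h : IsWeakGradient u g) (h' : IsWeakGradient u g') :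
    g =ᵐ[volume] g' := by
  refine ae_eq_of_integral_contDiff_smul_eq hg hg' fun φ hφ hs => ?_
  refine ext_inner_left ℝ fun v => ?_
  have key : ∀ {k : R3 → R3}, LocallyIntegrable k volume →
      inner ℝ v (∫ x, φ x • k x) = ∫ x, inner ℝ (k x) v * φ x := by
    intro k hk
    rw [← integral_inner (hk.integrable_smul_left_of_hasCompactSupport hφ.continuous hs)]
    refine integral_congr_ae (.of_forall fun x => ?_)
    simp only [inner_smul_right, real_inner_comm (k x) v]
    ring
  rw [key hg, key hg', ← neg_inj, ← h φ hφ hs v, ← h' φ hφ hs v]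

lemma IsWeakGradient.comp_add_right {u : R3 → ℝ} {g : R3 → R3} (h : IsWeakGradient u g)
    (y : R3) : IsWeakGradient (fun x => u (x + y)) (fun x => g (x + y)) := by
  intro φ hφ hs v
  have hφ' : ContDiff ℝ ∞ fun x => φ (x - y) := hφ.comp (contDiff_id.sub contDiff_const)
  have hs' : HasCompactSupport fun x => φ (x - y) := hs.comp_homeomorph (Homeomorph.subRight y)
  have e := h _ hφ' hs' v
  simp only [fderiv_comp_sub] at e
  rw [← integral_add_right_eq_self _ y, ← integral_add_right_eq_self (μ := volume)
    (fun x => inner ℝ (g x) v * φ (x - y)) y] at e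
  simpa only [add_sub_cancel_right] using e

lemma MeasureTheory.MemLp.comp_add_right_R3 {F : Type*} [NormedAddCommGroup F] {p : ℝ≥0∞}
    {f : R3 → F} (hf : MemLp f p volume) (y : R3) : MemLp (fun x => f (x + y)) p volume :=
  hf.comp_measurePreserving (measurePreserving_add_right volume y)

lemma MemH1.comp_add_right {u : R3 → ℝ} (hu : MemH1 u) (y : R3) :
    MemH1 (fun x => u (x + y)) :=
  ⟨hu.1.comp_add_right_R3 y, fun x => weakGrad u (x + y),
    hu.memLp_weakGrad.comp_add_right_R3 y, hu.isWeakGradient.comp_add_right y⟩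

/-- `weakGrad` is an arbitrary choice, so it commutes with translations only a.e., through
uniqueness of weak gradients. -/
lemma dirichletForm_comp_add_right {u : R3 → ℝ} (hu : MemH1 u) (y : R3) :
    dirichletForm (fun x => u (x + y)) = dirichletForm u := by
  have hae : weakGrad (fun x => u (x + y)) =ᵐ[volume] fun x => weakGrad u (x + y) :=
    IsWeakGradient.ae_eq ((hu.comp_add_right y).memLp_weakGrad.locallyIntegrable one_le_two)
      ((hu.memLp_weakGrad.comp_add_right_R3 y).locallyIntegrable one_le_two)
      (hu.comp_add_right y).isWeakGradient (hu.isWeakGradient.comp_add_right y)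
  rw [dirichletForm, dirichletForm,
    ← integral_add_right_eq_self (fun x => ‖weakGrad u x‖ ^ 2) y]
  refine integral_congr_ae ?_
  filter_upwards [hae] with x hx
  rw [hx]

lemma interactionForm_comp_add_right (a b : ℝ≥0∞) (u : R3 → ℝ) (z : R3) :
    interactionForm a b (fun x => u (x + z)) = interactionForm a b u := by
  rw [interactionForm, interactionForm, ← integral_add_right_eq_self
    (fun y => ∫ x, kernelK a b (x - y) * u x ^ 2 * u y ^ 2) z]
  refine integral_congr_ae (.of_forall fun y => ?_)
  simp only
  rw [← integral_add_right_eq_self (μ := volume)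
    (fun x => kernelK a b (x - (y + z)) * u x ^ 2 * u (y + z) ^ 2) z]
  simp only [add_sub_add_right_eq_sub]

lemma massSphere_comp_add_right {μ : ℝ} {u : R3 → ℝ} (hu : u ∈ massSphere μ) (y : R3) :
    (fun x => u (x + y)) ∈ massSphere μ :=
  ⟨hu.1.comp_add_right y, (integral_add_right_eq_self (fun x => u x ^ 2) y).trans hu.2⟩

end Translation

/-! ### Hölder estimates and form bounds for potentials. -/

section Potential

instance holderTriple_three_halves_three_one : ENNReal.HolderTriple (3 / 2) 3 1 where
  inv_add_inv_eq_inv := by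
    rw [ENNReal.inv_div (by simp) (by simp), ← one_div (3 : ℝ≥0∞), ENNReal.div_add_div_same, inv_one]
    norm_num
    exact ENNReal.div_self (by simp) (by simp)

instance holderTriple_six_six_three : ENNReal.HolderTriple 6 6 3 where
  inv_add_inv_eq_inv := by
    have h : (6 : ℝ≥0∞) = 2 * 3 := by norm_num
    rw [h, ENNReal.mul_inv (by simp) (by simp), ← add_mul, ENNReal.inv_two_add_inv_two, one_mul]

lemma integrable_mul_sq_of_memLp_three_halves {V u : R3 → ℝ} (hV : MemLp V (3 / 2) volume)
    (hu : MemLp u 6 volume) : Integrable (fun x => V x * u x ^ 2) volume := by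
  have h3 : MemLp (u * u) 3 volume := hu.mul hu
  have h1 : MemLp (V * (u * u)) 1 volume := h3.mul hV
  refine (memLp_one_iff_integrable.1 h1).congr (.of_forall fun x => ?_)
  simp [sq]

lemma integral_abs_mul_sq_le_of_memLp_three_halves {V u : R3 → ℝ} (hV : MemLp V (3 / 2) volume)
    (hu : MemLp u 6 volume) :
    ∫ x, |V x| * u x ^ 2 ≤ lpNorm V (3 / 2) volume * lpNorm u 6 volume ^ 2 := by
  have h1 : eLpNorm (V • (u • u)) 1 volume
      ≤ eLpNorm V (3 / 2) volume * (eLpNorm u 6 volume * eLpNorm u 6 volume) := by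
    refine (eLpNorm_smul_le_mul_eLpNorm (p := 3 / 2) (q := 3) (hu.1.smul hu.1) hV.1).trans ?_
    gcongr
    exact eLpNorm_smul_le_mul_eLpNorm (p := 6) (q := 6) hu.1 hu.1
  have h2 : ∫ x, |V x| * u x ^ 2 = (eLpNorm (V • (u • u)) 1 volume).toReal := by
    rw [toReal_eLpNorm (hV.1.smul (hu.1.smul hu.1)),
      lpNorm_one_eq_integral_norm (hV.1.smul (hu.1.smul hu.1))]
    refine integral_congr_ae (.of_forall fun x => ?_)
    simp [sq]
  rw [h2, ← toReal_eLpNorm hV.1, ← toReal_eLpNorm hu.1, sq, ← ENNReal.toReal_mul,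
    ← ENNReal.toReal_mul]
  exact ENNReal.toReal_mono (ENNReal.mul_ne_top hV.eLpNorm_ne_top
    (ENNReal.mul_ne_top hu.eLpNorm_ne_top hu.eLpNorm_ne_top)) h1

lemma integrable_mul_sq_of_memLp_top {V u : R3 → ℝ} (hV : MemLp V ⊤ volume)
    (hu : MemLp u 2 volume) : Integrable (fun x => V x * u x ^ 2) volume :=
  memLp_one_iff_integrable.1 ((memLp_one_iff_integrable.2 hu.integrable_sq).mul hV)

lemma integral_abs_mul_sq_le_of_memLp_top {V u : R3 → ℝ} (hV : MemLp V ⊤ volume)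
    (hu : MemLp u 2 volume) :
    ∫ x, |V x| * u x ^ 2 ≤ lpNorm V ⊤ volume * ∫ x, u x ^ 2 := by
  rw [← integral_const_mul]
  refine integral_mono_ae (integrable_mul_sq_of_memLp_top hV.norm hu)
    (hu.integrable_sq.const_mul _) ?_
  filter_upwards [ae_le_lpNorm_exponent_top hV] with x hx
  exact mul_le_mul_of_nonneg_right hx (sq_nonneg _)

lemma MemL32AddLinf.integrable_mul_sq {V u : R3 → ℝ} (hV : MemL32AddLinf V) (hu : MemH1 u) :
    Integrable (fun x => V x * u x ^ 2) volume := by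
  obtain ⟨W, W', hW, hW', h⟩ := hV
  refine ((integrable_mul_sq_of_memLp_three_halves hW hu.memLp_six).add
    (integrable_mul_sq_of_memLp_top hW' hu.1)).congr ?_
  filter_upwards [h] with x hx
  simp [hx, add_mul]

lemma MemL32AddLinf.add {V V' : R3 → ℝ} (hV : MemL32AddLinf V) (hV' : MemL32AddLinf V') :
    MemL32AddLinf (V + V') := by
  obtain ⟨W, W', hW, hW', h⟩ := hV
  obtain ⟨Z, Z', hZ, hZ', k⟩ := hV'
  refine ⟨W + Z, W' + Z', hW.add hZ, hW'.add hZ', ?_⟩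
  filter_upwards [h, k] with x hx kx
  simp only [Pi.add_apply] at *
  linarith

lemma VanishesAtInfinity.add {V V' : R3 → ℝ} (hV : VanishesAtInfinity V)
    (hV' : VanishesAtInfinity V') : VanishesAtInfinity (V + V') := by
  intro c hc
  refine (measure_mono ?_).trans_lt ((measure_union_le _ _).trans_lt
    (ENNReal.add_lt_top.2 ⟨hV (c / 2) (half_pos hc), hV' (c / 2) (half_pos hc)⟩))
  intro x hx
  by_contra hn
  simp only [mem_union, mem_ofPred_eq, not_or, not_lt, Pi.add_apply] at hn hx
  linarith [abs_add_le (V x) (V' x)]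

lemma dirichletForm_nonneg (u : R3 → ℝ) : 0 ≤ dirichletForm u :=
  integral_nonneg fun _ => by positivity

lemma dirichletForm_eq_lpNorm_sq {u : R3 → ℝ} (hu : MemH1 u) :
    dirichletForm u = lpNorm (weakGrad u) 2 volume ^ 2 := by
  have hg := hu.memLp_weakGrad
  rw [lpNorm_eq_integral_norm_rpow_toReal (by simp) (by simp) hg.1, ← Real.rpow_natCast,
    ← Real.rpow_mul (integral_nonneg fun _ => by positivity)]
  simp [dirichletForm]

lemma MemH1.lpNorm_six_sq_le {u : R3 → ℝ} (hu : MemH1 u) :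
    lpNorm u 6 volume ^ 2 ≤ sobolevConst ^ 2 * dirichletForm u := by
  rw [dirichletForm_eq_lpNorm_sq hu, ← mul_pow]
  refine pow_le_pow_left₀ lpNorm_nonneg ?_ 2
  rw [← toReal_eLpNorm hu.1.1, ← toReal_eLpNorm hu.memLp_weakGrad.1, ← ENNReal.coe_toReal,
    ← ENNReal.toReal_mul]
  exact ENNReal.toReal_mono
    (ENNReal.mul_ne_top ENNReal.coe_ne_top hu.memLp_weakGrad.eLpNorm_ne_top) hu.eLpNorm_six_le

/-- A function in `L^{3/2} + L^∞` is infinitesimally form bounded with respect to the Laplacian. -/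
theorem MemL32AddLinf.exists_integral_abs_mul_sq_le {V : R3 → ℝ} (hV : MemL32AddLinf V)
    {ε : ℝ} (hε : 0 < ε) :
    ∃ C : ℝ, 0 ≤ C ∧ ∀ u, MemH1 u →
      ∫ x, |V x| * u x ^ 2 ≤ ε * dirichletForm u + C * ∫ x, u x ^ 2 := by
  obtain ⟨W₀, W', hW₀, hW', hV₀⟩ := hV
  obtain ⟨W, hWs, hWW⟩ := hW₀.1
  have hW : MemLp W (3 / 2) volume := hW₀.ae_eq hWW
  -- The part of `W` above a high level has `L^{3/2}` norm at most `δ`, chosen so that Hölder and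
  -- Sobolev give `δ S² ≤ ε`, with `S` the Sobolev constant; the rest is bounded.
  set δ : ℝ := ε / (sobolevConst ^ 2 + 1) with hδ
  have hδ0 : 0 < δ := by positivity
  obtain ⟨M, hM⟩ := hW.eLpNorm_indicator_norm_ge_le hWs hδ0
  set A : Set R3 := {x | M ≤ ‖W x‖₊} with hA
  have hAm : MeasurableSet A :=
    measurableSet_le measurable_const hWs.measurable.nnnorm.coe_nnreal_real
  have h1 : MemLp (A.indicator W) (3 / 2) volume := hW.indicator hAm
  have h2 : MemLp (Aᶜ.indicator W) ⊤ volume := by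
    refine memLp_top_of_bound (hWs.indicator hAm.compl).aestronglyMeasurable |M|
      (.of_forall fun x => ?_)
    by_cases hx : x ∈ A
    · simp [hx]
    · have : x ∈ Aᶜ := hx
      rw [indicator_of_mem this]
      simp only [hA, mem_ofPred_eq, not_le, coe_nnnorm] at hx
      exact hx.le.trans (le_abs_self M)
  have hδW : lpNorm (A.indicator W) (3 / 2) volume ≤ δ := by
    rw [← toReal_eLpNorm h1.1]
    exact ENNReal.toReal_le_of_le_ofReal hδ0.le hM
  have h3 := h2.add hW'
  refine ⟨lpNorm (Aᶜ.indicator W + W') ⊤ volume, lpNorm_nonneg, fun u hu => ?_⟩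
  have i1 := integrable_mul_sq_of_memLp_three_halves h1.norm hu.memLp_six
  have i2 := integrable_mul_sq_of_memLp_top h3.norm hu.1
  have hle : ∫ x, |V x| * u x ^ 2 ≤ (∫ x, |A.indicator W x| * u x ^ 2)
      + ∫ x, |(Aᶜ.indicator W + W') x| * u x ^ 2 := by
    simp only [← Real.norm_eq_abs]
    rw [← integral_add i1 i2]
    refine integral_mono_of_nonneg (.of_forall fun x => by positivity) (i1.add i2) ?_
    filter_upwards [hV₀, hWW] with x hx hx'
    have e : V x = A.indicator W x + (Aᶜ.indicator W + W') x := by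
      rw [hx, Pi.add_apply, Pi.add_apply, hx', ← add_assoc, indicator_self_add_compl_apply]
    simp only [Pi.add_apply (ι := R3), Real.norm_eq_abs]
    rw [← add_mul, e]
    exact mul_le_mul_of_nonneg_right (abs_add_le _ _) (sq_nonneg _)
  have hb1 : ∫ x, |A.indicator W x| * u x ^ 2 ≤ ε * dirichletForm u := by
    calc _ ≤ lpNorm (A.indicator W) (3 / 2) volume * lpNorm u 6 volume ^ 2 :=
          integral_abs_mul_sq_le_of_memLp_three_halves h1 hu.memLp_six
      _ ≤ δ * (sobolevConst ^ 2 * dirichletForm u) := by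
          gcongr
          exact hu.lpNorm_six_sq_le
      _ = (δ * sobolevConst ^ 2) * dirichletForm u := by ring
      _ ≤ ε * dirichletForm u := by
          gcongr
          · exact dirichletForm_nonneg u
          · rw [hδ, div_mul_eq_mul_div, div_le_iff₀ (by positivity)]
            gcongr
            linarith
  exact hle.trans (add_le_add hb1 (integral_abs_mul_sq_le_of_memLp_top h3 hu.1))

end Potential

/-! ### The kernel as a potential, and the interaction bound. -/

section Kernel

lemma expNeg_nonneg (c : ℝ≥0∞) (r : ℝ) : 0 ≤ expNeg c r := by
  unfold expNeg
  split_ifs <;> positivity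

lemma expNeg_le_one (c : ℝ≥0∞) {r : ℝ} (hr : 0 ≤ r) : expNeg c r ≤ 1 := by
  unfold expNeg
  split_ifs
  · exact zero_le_one
  · rw [Real.exp_le_one_iff, neg_nonpos]
    positivity

lemma measurable_expNeg (c : ℝ≥0∞) : Measurable (expNeg c) := by
  unfold expNeg
  split_ifs <;> fun_prop

lemma measurable_kernelK (a b : ℝ≥0∞) : Measurable (kernelK a b) := by
  have ha := (measurable_expNeg a).comp (measurable_norm (α := R3))
  have hb := (measurable_expNeg b).comp (measurable_norm (α := R3))
  exact (measurable_const.div measurable_norm).mul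
    (((hb.const_mul _).sub (ha.const_mul _)).sub_const _)

lemma abs_kernelK_le (a b : ℝ≥0∞) (x : R3) : |kernelK a b x| ≤ 8 / 3 * ‖x‖⁻¹ := by
  have ha := expNeg_nonneg a ‖x‖
  have ha' := expNeg_le_one a (norm_nonneg x)
  have hb := expNeg_nonneg b ‖x‖
  have hb' := expNeg_le_one b (norm_nonneg x)
  rw [kernelK, one_div, abs_mul, abs_of_nonneg (inv_nonneg.2 (norm_nonneg x)), mul_comm]
  gcongr
  rw [abs_le]
  constructor <;> linarith

lemma memLp_inv_norm_restrict_ball :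
    MemLp (fun x : R3 => ‖x‖⁻¹) (3 / 2) (volume.restrict (Metric.ball 0 1)) := by
  have hm : Measurable fun x : R3 => ‖x‖⁻¹ := measurable_norm.inv
  rw [← integrable_norm_rpow_iff hm.aestronglyMeasurable (by simp)
    (ENNReal.div_ne_top (by simp) (by simp))]
  refine (integrableOn_fun_norm_addHaar (E := R3) volume
    (f := fun r => ‖r⁻¹‖ ^ (3 / 2 : ℝ≥0∞).toReal)).2 ?_
  refine Measure.integrableOn_of_bounded (M := 1) (by simp)
    (Measurable.aestronglyMeasurable (by fun_prop)) ?_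
  filter_upwards [ae_restrict_mem measurableSet_Ioo] with y hy
  have hy0 : 0 < y := hy.1
  -- In polar coordinates the integrand is `r² r^{-3/2}`, bounded by `r² r^{-2} = 1` on the unit
  -- interval.
  have h1 : 1 ≤ y⁻¹ := (one_le_inv₀ hy0).2 hy.2.le
  have h2 : (y⁻¹) ^ (3 / 2 : ℝ) ≤ (y⁻¹) ^ (2 : ℝ) :=
    Real.rpow_le_rpow_of_exponent_le h1 (by norm_num)
  have e : (3 / 2 : ℝ≥0∞).toReal = 3 / 2 := by simp
  rw [finrank_euclideanSpace_fin, e, smul_eq_mul, Real.norm_of_nonneg (by positivity),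
    Real.norm_of_nonneg (by positivity)]
  calc y ^ (3 - 1) * (y⁻¹) ^ (3 / 2 : ℝ) ≤ y ^ (3 - 1) * (y⁻¹) ^ (2 : ℝ) := by gcongr
    _ = 1 := by
      rw [Real.rpow_two, ← mul_pow, mul_inv_cancel₀ hy0.ne', one_pow]

lemma memL32AddLinf_kernelK (a b : ℝ≥0∞) : MemL32AddLinf (kernelK a b) := by
  have hK := measurable_kernelK a b
  set B : Set R3 := Metric.ball 0 1
  have hB : MeasurableSet B := Metric.isOpen_ball.measurableSet
  refine ⟨B.indicator (kernelK a b), Bᶜ.indicator (kernelK a b), ?_, ?_, ?_⟩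
  · rw [memLp_indicator_iff_restrict hB]
    refine (memLp_inv_norm_restrict_ball.const_mul (8 / 3)).mono hK.aestronglyMeasurable
      (.of_forall fun x => ?_)
    exact (abs_kernelK_le a b x).trans (le_abs_self _)
  · refine memLp_top_of_bound (hK.indicator hB.compl).aestronglyMeasurable (8 / 3)
      (.of_forall fun x => ?_)
    by_cases hx : x ∈ Bᶜ
    · rw [indicator_of_mem hx]
      refine (abs_kernelK_le a b x).trans (mul_le_of_le_one_right (by norm_num) ?_)
      exact inv_le_one_of_one_le₀ (by simpa [B] using hx)
    · rw [indicator_of_notMem hx, norm_zero]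
      norm_num
  · rw [indicator_self_add_compl]

/-- For fixed `y` the inner integral is a potential form of a translate of `u`. Its form bound does
not depend on `y`, and integrating against `u(y)²` gives one more factor of the mass. -/
lemma exists_abs_interactionForm_le (a b : ℝ≥0∞) {ε : ℝ} (hε : 0 < ε) :
    ∃ C : ℝ, 0 ≤ C ∧ ∀ u, MemH1 u →
      |interactionForm a b u| ≤ (ε * dirichletForm u + C * ∫ x, u x ^ 2) * ∫ x, u x ^ 2 := by
  obtain ⟨C, hC, h⟩ := (memL32AddLinf_kernelK a b).exists_integral_abs_mul_sq_le hε
  refine ⟨C, hC, fun u hu => ?_⟩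
  rw [← integral_const_mul, interactionForm, ← Real.norm_eq_abs]
  refine norm_integral_le_of_norm_le (hu.1.integrable_sq.const_mul _) (.of_forall fun y => ?_)
  rw [integral_mul_const, norm_mul, Real.norm_of_nonneg (sq_nonneg (u y))]
  gcongr
  have h1 := h _ (hu.comp_add_right y)
  rw [dirichletForm_comp_add_right hu, integral_add_right_eq_self (fun x => u x ^ 2) y] at h1
  refine le_trans ?_ h1
  rw [← integral_add_right_eq_self _ y]
  refine (norm_integral_le_integral_norm _).trans_eq ?_
  refine integral_congr_ae (.of_forall fun x => ?_)
  simp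

end Kernel

/-! ### Coercivity, energy deficiency and its stability. -/

section GroundState

variable {a b : ℝ≥0∞} {μ : ℝ}

lemma groundEnergy_le {V u : R3 → ℝ} (hu : u ∈ massSphere μ) :
    groundEnergy a b V μ ≤ energy a b V u := iInf₂_le u hu

lemma abs_potentialForm_le (V u : R3 → ℝ) : |potentialForm V u| ≤ ∫ x, |V x| * u x ^ 2 := by
  rw [potentialForm, ← Real.norm_eq_abs]
  refine (norm_integral_le_integral_norm _).trans_eq ?_
  simp

/-- Coercivity of the energy on the mass sphere. -/
lemma exists_dirichletForm_le_energy {V : R3 → ℝ} (hV : MemL32AddLinf V) (hμ : 0 < μ) :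
    ∃ C : ℝ, ∀ u ∈ massSphere μ, 1 / 4 * dirichletForm u - C ≤ energy a b V u := by
  -- With these choices of `ε` the potential and the interaction each absorb `1/8` of the Dirichlet
  -- form, leaving `1/2 - 1/8 - 1/8 = 1/4`.
  obtain ⟨C, -, hC⟩ := hV.exists_integral_abs_mul_sq_le (ε := 1 / 4) (by norm_num)
  obtain ⟨C', -, hC'⟩ := exists_abs_interactionForm_le a b (ε := 1 / (2 * μ)) (by positivity)
  refine ⟨1 / 2 * (C * μ) + 1 / 4 * (C' * μ * μ), fun u hu => ?_⟩
  have h1 := hC u hu.1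
  have h2 := hC' u hu.1
  rw [hu.2] at h1 h2
  have h3 := abs_potentialForm_le V u
  have h4 : (1 / (2 * μ) * dirichletForm u + C' * μ) * μ
      = 1 / 2 * dirichletForm u + C' * μ * μ := by
    field_simp
  rw [h4] at h2
  have h5 := neg_abs_le (potentialForm V u)
  have h6 := neg_abs_le (interactionForm a b u)
  rw [energy]
  linarith

lemma groundEnergy_ne_bot {V : R3 → ℝ} (hV : MemL32AddLinf V) (hμ : 0 < μ) :
    groundEnergy a b V μ ≠ ⊥ := by
  obtain ⟨C, hC⟩ := exists_dirichletForm_le_energy (a := a) (b := b) hV hμ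
  refine ne_bot_of_le_ne_bot (EReal.coe_ne_bot (-C)) (le_iInf₂ fun u hu => ?_)
  have := hC u hu
  have := dirichletForm_nonneg u
  exact EReal.coe_le_coe_iff.2 (by linarith)

lemma potentialForm_add {V W u : R3 → ℝ} (hV : MemL32AddLinf V) (hW : MemL32AddLinf W)
    (hu : MemH1 u) : potentialForm (V + W) u = potentialForm V u + potentialForm W u := by
  rw [potentialForm, potentialForm, potentialForm,
    ← integral_add (hV.integrable_mul_sq hu) (hW.integrable_mul_sq hu)]
  simp [add_mul]

/-- A nonpositive potential that is not a.e. zero lowers the energy of some translate. -/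
lemma exists_potentialForm_comp_add_right_neg {V u : R3 → ℝ} (hV : MemL32AddLinf V)
    (hV0 : ¬ V =ᵐ[volume] 0) (hVn : V ≤ᵐ[volume] 0) (hu : MemH1 u)
    (hpos : 0 < ∫ x, u x ^ 2) : ∃ y : R3, potentialForm V (fun x => u (x + y)) < 0 := by
  by_contra! hcon
  have hVm : AEMeasurable V volume := by
    obtain ⟨W, W', hW, hW', h⟩ := hV
    exact (hW.1.add hW'.1).aemeasurable.congr h.symm
  have hVm' : AEMeasurable (fun x => ENNReal.ofReal (-V x)) volume := hVm.neg.ennreal_ofReal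
  have hum : AEMeasurable (fun x => ENNReal.ofReal (u x ^ 2)) volume :=
    (hu.1.1.aemeasurable.pow_const 2).ennreal_ofReal
  -- As `V ≤ 0`, the contrary assumption makes every translated potential term vanish. Lower
  -- integrals are used because `V` need not be integrable.
  have hzero : ∀ y, ∫⁻ x, ENNReal.ofReal (-V x) * ENNReal.ofReal (u (x + y) ^ 2) = 0 := by
    intro y
    have hint := (hV.integrable_mul_sq (hu.comp_add_right y)).neg
    have h0 : 0 ≤ᵐ[volume] fun x => -(V x * u (x + y) ^ 2) := by
      filter_upwards [hVn] with x hx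
      exact neg_nonneg.2 (mul_nonpos_of_nonpos_of_nonneg hx (sq_nonneg _))
    have h1 := ofReal_integral_eq_lintegral_ofReal hint h0
    have h2 : ∫ x, -(V x * u (x + y) ^ 2) ≤ 0 := by
      rw [integral_neg]
      exact neg_nonpos.2 (hcon y)
    simp only [Pi.neg_apply] at h1
    rw [ENNReal.ofReal_of_nonpos h2] at h1
    rw [h1]
    refine lintegral_congr_ae ?_
    filter_upwards [hVn] with x hx
    rw [← ENNReal.ofReal_mul (neg_nonneg.2 hx), neg_mul]
  -- Tonelli factorizes the average over translations; a zero product means `V = 0` a.e. or zero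
  -- mass.
  have hswap : ∫⁻ y, ∫⁻ x, ENNReal.ofReal (-V x) * ENNReal.ofReal (u (x + y) ^ 2)
      = (∫⁻ x, ENNReal.ofReal (-V x)) * ∫⁻ x, ENNReal.ofReal (u x ^ 2) := by
    rw [lintegral_lintegral_swap]
    · rw [← lintegral_mul_const'' _ hVm']
      refine lintegral_congr fun x => ?_
      rw [lintegral_const_mul' _ _ ENNReal.ofReal_ne_top,
        lintegral_add_left_eq_self (fun y => ENNReal.ofReal (u y ^ 2)) x]
    · exact (hVm'.comp_quasiMeasurePreserving Measure.quasiMeasurePreserving_snd).mul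
        (hum.comp_quasiMeasurePreserving
          ((quasiMeasurePreserving_add volume volume).comp
            (Measure.measurePreserving_swap).quasiMeasurePreserving))
  simp only [hzero, lintegral_zero] at hswap
  rw [← ofReal_integral_eq_lintegral_ofReal hu.1.integrable_sq
    (.of_forall fun x => sq_nonneg _), eq_comm, mul_eq_zero] at hswap
  rcases hswap with h | h
  · rw [lintegral_eq_zero_iff' hVm'] at h
    refine hV0 ?_
    filter_upwards [h, hVn] with x hx hxn
    have : -V x ≤ 0 := ENNReal.ofReal_eq_zero.1 hx
    exact le_antisymm hxn (by simpa using this)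
  · exact hpos.not_ge (ENNReal.ofReal_eq_zero.1 h)

theorem energyDeficient_of_nonpos {V : R3 → ℝ} (hμ : 0 < μ) (hV : MemL32AddLinf V)
    (hgs : ∃ u, IsGroundState a b 0 μ u) (hV0 : ¬ V =ᵐ[volume] 0) (hVn : V ≤ᵐ[volume] 0) :
    EnergyDeficient a b V μ := by
  obtain ⟨u, hu, hmin⟩ := hgs
  obtain ⟨y, hy⟩ := exists_potentialForm_comp_add_right_neg hV hV0 hVn hu.1 (hu.2 ▸ hμ)
  refine (groundEnergy_le (massSphere_comp_add_right hu y)).trans_lt ?_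
  rw [← hmin, EReal.coe_lt_coe_iff, energy, energy, dirichletForm_comp_add_right hu.1,
    interactionForm_comp_add_right]
  have h0 : potentialForm 0 u = 0 := by simp [potentialForm]
  linarith

/-- If the ground state energy is approached along functions whose squared `L⁶` norm is bounded
by `2K`, then `K` is a perturbation constant. -/
lemma isPerturbationConstant_of_forall_exists {V₁ : R3 → ℝ} {K E₁ : ℝ}
    (h₁ : IsAdmissiblePotential a b V₁ μ) (hE₁ : groundEnergy a b V₁ μ = E₁)
    (h : ∀ η > 0, ∃ u ∈ massSphere μ, energy a b V₁ u ≤ E₁ + η ∧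
      1 / 2 * lpNorm u 6 volume ^ 2 ≤ K) :
    IsPerturbationConstant a b V₁ μ K := by
  intro V₂ V₃ hV₂ hV₃ hvan hlt
  have hV₂' : MemL32AddLinf V₂ := ⟨V₂, 0, hV₂, MemLp.zero, by simp⟩
  have hV₃' : MemL32AddLinf V₃ := ⟨0, V₃, MemLp.zero, hV₃, by simp⟩
  refine ⟨(h₁.1.add hV₂').add hV₃', by rw [add_assoc]; exact h₁.2.1.add hvan, ?_⟩
  have hdef : (E₁ : EReal) < groundEnergy a b 0 μ := hE₁ ▸ h₁.2.2
  obtain ⟨u₀, hu₀, -⟩ := h 1 one_pos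
  obtain ⟨E₀, hE₀⟩ : ∃ E₀ : ℝ, groundEnergy a b 0 μ = E₀ :=
    ⟨_, (EReal.coe_toReal ((groundEnergy_le hu₀).trans_lt (EReal.coe_lt_top _)).ne
      hdef.ne_bot).symm⟩
  rw [hE₀, hE₁, ← EReal.coe_sub, EReal.coe_lt_coe_iff] at hlt
  -- Half of the gap is spent on near-minimality, so the final inequality stays strict.
  obtain ⟨u, hu, hen, hK⟩ := h
    ((E₀ - E₁ - (K * lpNorm V₂ (3 / 2) volume + 1 / 2 * lpNorm V₃ ⊤ volume * μ)) / 2)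
    (by linarith)
  refine (groundEnergy_le hu).trans_lt ?_
  rw [hE₀, EReal.coe_lt_coe_iff]
  have e : energy a b (V₁ + V₂ + V₃) u
      = energy a b V₁ u + 1 / 2 * potentialForm V₂ u + 1 / 2 * potentialForm V₃ u := by
    rw [energy, energy, potentialForm_add (h₁.1.add hV₂') hV₃' hu.1,
      potentialForm_add h₁.1 hV₂' hu.1]
    ring
  have h2 : potentialForm V₂ u ≤ lpNorm V₂ (3 / 2) volume * lpNorm u 6 volume ^ 2 :=
    ((le_abs_self _).trans (abs_potentialForm_le _ _)).trans
      (integral_abs_mul_sq_le_of_memLp_three_halves hV₂ hu.1.memLp_six)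
  have h3 : potentialForm V₃ u ≤ lpNorm V₃ ⊤ volume * μ :=
    hu.2 ▸ ((le_abs_self _).trans (abs_potentialForm_le _ _)).trans (integral_abs_mul_sq_le_of_memLp_top hV₃ hu.1.1)
  have h4 : lpNorm V₂ (3 / 2) volume * (1 / 2 * lpNorm u 6 volume ^ 2)
      ≤ lpNorm V₂ (3 / 2) volume * K := mul_le_mul_of_nonneg_left hK lpNorm_nonneg
  rw [e]
  linarith

theorem exists_isPerturbationConstant {V₁ : R3 → ℝ} (hμ : 0 < μ)
    (h₁ : IsAdmissiblePotential a b V₁ μ) :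
    ∃ K : ℝ, 0 < K ∧ IsPerturbationConstant a b V₁ μ K := by
  obtain ⟨E₁, hE₁⟩ : ∃ E₁ : ℝ, groundEnergy a b V₁ μ = E₁ :=
    ⟨_, (EReal.coe_toReal h₁.2.2.ne_top (groundEnergy_ne_bot h₁.1 hμ)).symm⟩
  obtain ⟨C, hC⟩ := exists_dirichletForm_le_energy (a := a) (b := b) h₁.1 hμ
  -- Coercivity gives `∫|∇u|² ≤ 4(E₁ + 1 + C)` for trial functions within `1` of the infimum; the
  -- maximum with `1` ensures positivity.
  set K : ℝ := max 1 (1 / 2 * (sobolevConst ^ 2 * (4 * (E₁ + 1 + C)))) with hKdef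
  refine ⟨K, lt_of_lt_of_le one_pos (le_max_left _ _),
    isPerturbationConstant_of_forall_exists h₁ hE₁ fun η hη => ?_⟩
  have hlt : groundEnergy a b V₁ μ < ((E₁ + min η 1 : ℝ) : EReal) := by
    rw [hE₁, EReal.coe_lt_coe_iff]
    linarith [lt_min hη one_pos]
  rw [groundEnergy] at hlt
  obtain ⟨u, hu⟩ := iInf_lt_iff.1 hlt
  obtain ⟨hus, hlt'⟩ := iInf_lt_iff.1 hu
  rw [EReal.coe_lt_coe_iff] at hlt'
  refine ⟨u, hus, by linarith [min_le_left η 1], ?_⟩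
  refine le_trans ?_ (le_max_right _ _)
  have hD : dirichletForm u ≤ 4 * (E₁ + 1 + C) := by
    linarith [hC u hus, min_le_right η 1]
  have h6 := hus.1.lpNorm_six_sq_le
  gcongr
  exact h6.trans (by gcongr)

lemma lpNorm_six_pos {u : R3 → ℝ} (hμ : 0 < μ) (hu : u ∈ massSphere μ) :
    0 < lpNorm u 6 volume := by
  refine lpNorm_nonneg.lt_of_ne' fun h => hμ.ne ?_
  rw [lpNorm_eq_zero hu.1.memLp_six (by simp)] at h
  rw [← hu.2, integral_eq_zero_of_ae]
  filter_upwards [h] with x hx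
  simp [hx]

lemma IsGroundState.isPerturbationConstant {V₁ u : R3 → ℝ}
    (h₁ : IsAdmissiblePotential a b V₁ μ) (hu : IsGroundState a b V₁ μ u) :
    IsPerturbationConstant a b V₁ μ (1 / 2 * lpNorm u 6 volume ^ 2) :=
  isPerturbationConstant_of_forall_exists h₁ hu.2.symm fun _ hη =>
    ⟨u, hu.1, le_add_of_nonneg_right hη.le, le_rfl⟩

end GroundState

theorem mainTheorem6 (a b : ℝ≥0∞) (μ : ℝ) (hμ : 0 < μ) :
    (∀ V : R3 → ℝ, MemL32AddLinf V → (∃ u, IsGroundState a b 0 μ u) →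
      ¬ (V =ᵐ[volume] 0) → V ≤ᵐ[volume] 0 → EnergyDeficient a b V μ) ∧
    (∀ V₁ : R3 → ℝ, IsAdmissiblePotential a b V₁ μ →
      (∃ K : ℝ, 0 < K ∧ IsPerturbationConstant a b V₁ μ K) ∧
      (∀ u : R3 → ℝ, IsGroundState a b V₁ μ u →
        MemLp u 6 volume ∧ 0 < 1 / 2 * lpNorm u 6 volume ^ 2 ∧
          IsPerturbationConstant a b V₁ μ (1 / 2 * lpNorm u 6 volume ^ 2))) := by
  refine ⟨fun V hV hgs hV0 hVn => energyDeficient_of_nonpos hμ hV hgs hV0 hVn,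
    fun V₁ h₁ => ⟨exists_isPerturbationConstant hμ h₁, fun u hu => ⟨hu.1.1.memLp_six, ?_,
      hu.isPerturbationConstant h₁⟩⟩⟩
  have := lpNorm_six_pos hμ hu.1
  positivity
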